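/- Let $A=(A_1,\dots,A_g)$ and $B=(B_1,\dots,B_h)$ be tuples of real symmetric $d\times d$ matrices. For tuples $C=(C_1,\dots,C_k)$ of $r\times r$ matrices and $X=(X_1,\dots,X_k)$ of $n\times n$ matrices put $$\Lambda_C(X)=\sum_{i=1}^k C_i\otimes X_i,\qquad L_C(X)=I_r\otimes I_n-\Lambda_C(X).$$ For each $n$ let $\mathrm{proj}_x\mathcal D_{(A,B)}(n)$ be the set of $g$-tuples $X$ of real symmetric $n\times n$ matrices for which there is an $h$-tuple $Y$ of real symmetric $n\times n$ matrices with $I_d\otimes I_n-\Lambda_A(X)-\Lambda_B(Y)\succeq 0$. Assume that the free spectrahedrop $\mathrm{proj}_x\mathcal D_{(A,B)}=\bigcup_n\mathrm{proj}_x\mathcal D_{(A,B)}(n)$ is closed (each level $\mathrm{proj}_x\mathcal D_{(A,B)}(n)$ is closed) and bounded (there is a real $C$ such that $C I_n-\sum_{i=1}^g X_i^2\succeq 0$ for all $n$ and all $X\in\mathrm{proj}_x\mathcal D_{(A,B)}(n)$). For a $d\times d$ matrix $M$ let $M^{\oplus N}$ be the direct sum of $N$ copies of $M$, and for a tuple $C$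 of $d\times d$ matrices write $W^*C^{\oplus N}W$ for the tuple with entries $W^*C_i^{\oplus N}W$. Define $$\mathcal Z_B(n)=\{W\in M_{nd^2\times n}(\mathbb R): W^*B^{\oplus nd}W=0\},$$ $$\mathcal I_B(n,r)=\{W\in M_{nd^2\times r}(\mathbb R): W^*B^{\oplus nd}W=0,\ W^*W=I_r\},\qquad \mathcal I_B(n)=\bigcup_{r\le n}\mathcal I_B(n,r).$$ Let $X$ be a $g$-tuple of real symmetric $n\times n$ matrices. Then: 1. $X\in\mathrm{proj}_x\mathcal D_{(A,B)}(n)$ if and only if $W^*W\otimes I_n-\Lambda_{W^*A^{\oplus nd}W}(X)\succeq 0$ for all $W\in\mathcal Z_B(n)$. 2. $X\in\mathrm{proj}_x\mathcal D_{(A,B)}(n)$ if and only if $L_{W^*A^{\oplus nd}W}(X)\succeq 0$ for all $W\in\mathcal I_B(n)$. 3. If $X\in\mathrm{proj}_x\mathcal D_{(A,B)}(n)$, then $L_{W^*A^{\oplus md}W}(X)\succeq 0$ for all $m\in\mathbb N$ and all $W\in\mathcal I_B(m)$. -/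

import Mathlib

open scoped Kronecker Matrix

/-- `Λ_A(X) = ∑ i, A i ⊗ X i`, the homogeneous linear part of the monic pencil with
coefficients `A`, evaluated at the matrix tuple `X`. -/
noncomputable def linearPart {ι m k : Type*} [Fintype ι]
    (A : ι → Matrix m m ℝ) (X : ι → Matrix k k ℝ) : Matrix (m × k) (m × k) ℝ :=
  ∑ i, A i ⊗ₖ X i

/-- `L_A(X) = I ⊗ I - ∑ i, A i ⊗ X i`, the evaluation at `X` of the monic linear pencil with
coefficients `A`. -/
noncomputable def monicPencil {ι m k : Type*} [Fintype ι] [DecidableEq m] [DecidableEq k]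
    (A : ι → Matrix m m ℝ) (X : ι → Matrix k k ℝ) : Matrix (m × k) (m × k) ℝ :=
  (1 : Matrix m m ℝ) ⊗ₖ (1 : Matrix k k ℝ) - linearPart A X

/-- The set of tuples of self-adjoint (real symmetric) `n × n` matrices. -/
def selfAdjointTuples (ι : Type*) (n : ℕ) : Set (ι → Matrix (Fin n) (Fin n) ℝ) :=
  {X | ∀ i, (X i).IsHermitian}

/-- The level `n` of the free spectrahedron of `A`: the tuples `X` of self-adjoint `n × n`
matrices such that `L_A(X)` is positive semidefinite. -/
def freeSpectrahedron {ι : Type*} [Fintype ι] {d : ℕ} (A : ι → Matrix (Fin d) (Fin d) ℝ)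
    (n : ℕ) : Set (ι → Matrix (Fin n) (Fin n) ℝ) :=
  {X | X ∈ selfAdjointTuples ι n ∧ (monicPencil A X).PosSemidef}

/-- The level `n` of the free spectrahedrop `proj_x D_(A,B)`. A `(g + h)`-tuple `(A, B)` is
represented as the family `Sum.elim A B` indexed by `Fin g ⊕ Fin h`. -/
def freeSpectrahedrop {g h d : ℕ} (A : Fin g → Matrix (Fin d) (Fin d) ℝ)
    (B : Fin h → Matrix (Fin d) (Fin d) ℝ) (n : ℕ) :
    Set (Fin g → Matrix (Fin n) (Fin n) ℝ) :=
  {X | X ∈ selfAdjointTuples (Fin g) n ∧ ∃ Y ∈ selfAdjointTuples (Fin h) n,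
    Sum.elim X Y ∈ freeSpectrahedron (Sum.elim A B) n}

/-- A dimension-free set (given by its levels) is closed if each level is closed. -/
def IsFreeClosed {g : ℕ} (K : (n : ℕ) → Set (Fin g → Matrix (Fin n) (Fin n) ℝ)) : Prop :=
  ∀ n, 0 < n → IsClosed (K n)

/-- A dimension-free set is bounded if, for one real constant `C`, the matrix
`C I - ∑ i, (X i) ^ 2` is positive semidefinite for all its elements `X`, at all levels. -/
def IsFreeBounded {g : ℕ} (K : (n : ℕ) → Set (Fin g → Matrix (Fin n) (Fin n) ℝ)) : Prop :=
  ∃ C : ℝ, ∀ n, 0 < n → ∀ X ∈ K n,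
    (C • (1 : Matrix (Fin n) (Fin n) ℝ) - ∑ i, X i ^ 2).PosSemidef

/-- The direct sum `M^{⊕ N}` of `N` copies of a `d × d` matrix `M`, as the block diagonal matrix
on the index set `Fin d × Fin N`, whose second component numbers the copies. -/
def directSumCopies {d : ℕ} (M : Matrix (Fin d) (Fin d) ℝ) (N : ℕ) :
    Matrix (Fin d × Fin N) (Fin d × Fin N) ℝ :=
  Matrix.blockDiagonal fun _ : Fin N => M

/-- The tuple `W* A^{⊕ N} W`, with entries `W* (A i)^{⊕ N} W`, for a linear map
`W : ℝ^r → (ℝ^d)^N`. -/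
def compression {ι : Type*} {d N r : ℕ} (A : ι → Matrix (Fin d) (Fin d) ℝ)
    (W : Matrix (Fin d × Fin N) (Fin r) ℝ) : ι → Matrix (Fin r) (Fin r) ℝ :=
  fun i => Wᴴ * directSumCopies (A i) N * W

/-- `Z_B(n)`: the linear maps `W : ℝ^n → (ℝ^d)^(n d)` with `W* B^{⊕ n d} W = 0`. -/
def setZ {h d : ℕ} (B : Fin h → Matrix (Fin d) (Fin d) ℝ) (n : ℕ) :
    Set (Matrix (Fin d × Fin (n * d)) (Fin n) ℝ) :=
  {W | compression B W = 0}

/-- `I_B(n, r)`: the isometries `W : ℝ^r → (ℝ^d)^(n d)` with `W* B^{⊕ n d} W = 0`. -/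
def setI {h d : ℕ} (B : Fin h → Matrix (Fin d) (Fin d) ℝ) (n r : ℕ) :
    Set (Matrix (Fin d × Fin (n * d)) (Fin r) ℝ) :=
  {W | compression B W = 0 ∧ Wᴴ * W = 1}

/-- `I_B(n)`: the union of the sets `I_B(n, r)` over `r ≤ n`. Its elements have varying numbers
of columns, so an element is a pair of `r` and a matrix with `r` columns. -/
def setIUnion {h d : ℕ} (B : Fin h → Matrix (Fin d) (Fin d) ℝ) (n : ℕ) :
    Set (Σ r : ℕ, Matrix (Fin d × Fin (n * d)) (Fin r) ℝ) :=
  {W | W.1 ≤ n ∧ W.2 ∈ setI B n W.1}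

/-!
If `W* B^{⊕ N} W = 0`, then the completely positive map `M ↦ W* M^{⊕ N} W`, amplified by the
identity, eliminates the variables `Y` from `L_{(A,B)}(X, Y) ⪰ 0`.

Conversely, if `L_A(X)` is not in the closure of the cone of all `P + Λ_B(Y)` with `P ⪰ 0`, then
the bipolar theorem provides a matrix `P ⪰ 0` orthogonal to the range of `Λ_B` with
`tr (P L_A(X)) < 0`. Write `P = V* V` and cut the `nd` rows of `V`, which lie in `ℝ^d ⊗ ℝ^n`, into
the blocks of a map `W : ℝ^n → (ℝ^d)^{nd}`. Then `tr (P Z)` is the compression of `Z` by `W`,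
evaluated at the vector `∑ j, e_j ⊗ e_j`; so orthogonality says `W ∈ Z_B(n)`, and the compression
of `L_A(X)` by `W` is not positive semidefinite. Membership of `L_A(X)` in the closure gives
`(1 + ε) I - Λ_A(X) - Λ_B(Y) ⪰ 0` for every `ε > 0`, that is, `(1 + ε)⁻¹ X` in the spectrahedrop.

Restricting `W` to isometries loses nothing, because `W = U S` for an isometry `U` with the same
range.
-/

open scoped MatrixOrder Matrix.Norms.L2Operator in
theorem posSemidef_smul_one_sub_of_norm_le {m : Type*} [Fintype m] [DecidableEq m]
    {E : Matrix m m ℝ} (hE : E.IsHermitian) {ε : ℝ} (h : ‖E‖ ≤ ε) :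
    (ε • (1 : Matrix m m ℝ) - E).PosSemidef := by
  rw [← Matrix.le_iff, ← Algebra.algebraMap_eq_smul_one]
  cases isEmpty_or_nonempty m
  · exact (Subsingleton.elim _ _).le
  · exact le_algebraMap_of_spectrum_le (fun r hr =>
      (Real.le_norm_self r).trans ((spectrum.norm_le_norm_of_mem hr).trans h)) hE

theorem exists_eq_trace_mul {R m : Type*} [CommSemiring R] [Fintype m]
    (f : Matrix m m R →ₗ[R] R) : ∃ G : Matrix m m R, ∀ M, f M = (G * M).trace := by
  classical
  refine ⟨Matrix.of fun i j => f (Matrix.single j i 1), fun M => ?_⟩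
  suffices f = Matrix.traceLinearMap m R R ∘ₗ LinearMap.mulLeft R
      (Matrix.of fun i j => f (Matrix.single j i 1)) from LinearMap.congr_fun this M
  refine Matrix.ext_linearMap R fun i j => LinearMap.ext_ring ?_
  simp [Matrix.trace_mul_single]

theorem exists_posSemidef_eq_trace_mul {m : Type*} [Fintype m]
    (f : Matrix m m ℝ →ₗ[ℝ] ℝ) (hf : ∀ P : Matrix m m ℝ, P.PosSemidef → 0 ≤ f P) :
    ∃ P : Matrix m m ℝ, P.PosSemidef ∧
      ∀ M : Matrix m m ℝ, M.IsHermitian → f M = (P * M).trace := by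
  obtain ⟨G, hG⟩ := exists_eq_trace_mul f
  have htrace (M : Matrix m m ℝ) (hM : M.IsHermitian) :
      f M = (((2 : ℝ)⁻¹ • (G + Gᴴ)) * M).trace := by
    have hconj : (Gᴴ * M).trace = (G * M).trace := by
      rw [← Matrix.trace_mul_comm M G, ← star_trivial (M * G).trace, ← Matrix.trace_conjTranspose,
        Matrix.conjTranspose_mul, hM.eq]
    rw [Matrix.smul_mul, Matrix.trace_smul, Matrix.add_mul, Matrix.trace_add, hconj, hG,
      smul_eq_mul]
    ring
  refine ⟨_, .of_dotProduct_mulVec_nonneg ?_ fun x => ?_, htrace⟩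
  · exact (Matrix.isHermitian_add_transpose_self G).smul (.all _)
  · have hx := Matrix.posSemidef_vecMulVec_self_star x
    have := hf _ hx
    rwa [htrace _ hx.isHermitian, Matrix.mul_vecMulVec, Matrix.trace_vecMulVec,
      dotProduct_comm] at this

open scoped MatrixOrder Matrix.Norms.L2Operator Pointwise in
theorem mem_closure_posSemidef_add_of_trace_nonneg {m : Type*} [Fintype m]
    {S : Submodule ℝ (Matrix m m ℝ)} (hS : ∀ s ∈ S, s.IsHermitian)
    {M : Matrix m m ℝ} (hM : M.IsHermitian)
    (hdual : ∀ P : Matrix m m ℝ, P.PosSemidef → (∀ s ∈ S, (P * s).trace = 0) →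
      0 ≤ (P * M).trace) :
    M ∈ closure ({P : Matrix m m ℝ | P.PosSemidef} + (S : Set (Matrix m m ℝ))) := by
  classical
  let K : ProperCone ℝ (Matrix m m ℝ) :=
    Submodule.closure (PointedCone.positive ℝ (Matrix m m ℝ) ⊔ PointedCone.ofSubmodule S)
  have hK : (K : Set (Matrix m m ℝ)) =
      closure ({P : Matrix m m ℝ | P.PosSemidef} + (S : Set (Matrix m m ℝ))) := by
    have hpos : {P : Matrix m m ℝ | P.PosSemidef} = PointedCone.positive ℝ (Matrix m m ℝ) :=
      Set.ext fun P => Matrix.nonneg_iff_posSemidef.symm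
    rw [hpos]
    exact congrArg closure (Submodule.coe_sup _ _)
  rw [← hK]
  by_contra hMK
  obtain ⟨f, hfK, hfM⟩ := K.hyperplane_separation_point hMK
  have hfPS (P s : Matrix m m ℝ) (hP : P.PosSemidef) (hs : s ∈ S) : 0 ≤ f (P + s) :=
    hfK _ (hK.superset (subset_closure (Set.add_mem_add hP hs)))
  obtain ⟨P, hP, hfP⟩ := exists_posSemidef_eq_trace_mul f.toLinearMap fun P hP => by
    simpa using hfPS P 0 hP S.zero_mem
  have hPS (s : Matrix m m ℝ) (hs : s ∈ S) : (P * s).trace = 0 := by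
    have hpos := hfPS 0 s .zero hs
    have hneg := hfPS 0 (-s) .zero (S.neg_mem hs)
    rw [zero_add] at hpos hneg
    rw [map_neg] at hneg
    rw [← hfP s (hS s hs)]
    exact le_antisymm (neg_nonneg.mp hneg) hpos
  exact ((hdual P hP hPS).trans_eq (hfP M hM).symm).not_gt hfM

open scoped Matrix.Norms.L2Operator Pointwise in
theorem exists_posSemidef_smul_one_add_sub_of_mem_closure {m : Type*} [Finite m] [DecidableEq m]
    {S : Set (Matrix m m ℝ)} (hS : ∀ s ∈ S, s.IsHermitian)
    {M : Matrix m m ℝ} (hM : M.IsHermitian)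
    (hMS : M ∈ closure ({P : Matrix m m ℝ | P.PosSemidef} + S)) {ε : ℝ} (hε : 0 < ε) :
    ∃ s ∈ S, (ε • (1 : Matrix m m ℝ) + M - s).PosSemidef := by
  have := Fintype.ofFinite m
  obtain ⟨_, ⟨P, hP, s, hs, rfl⟩, hdist⟩ := Metric.mem_closure_iff.mp hMS ε hε
  rw [dist_comm, dist_eq_norm] at hdist
  have hherm : (P + s - M).IsHermitian := (hP.isHermitian.add (hS s hs)).sub hM
  refine ⟨s, hs, ?_⟩
  convert (posSemidef_smul_one_sub_of_norm_le hherm hdist.le).add hP using 1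
  module

theorem isClosed_setOf_posSemidef {m : Type*} [Finite m] :
    IsClosed {M : Matrix m m ℝ | M.PosSemidef} := by
  have := Fintype.ofFinite m
  simp only [Matrix.posSemidef_iff_dotProduct_mulVec, Set.ofPred_and, Set.ofPred_forall]
  exact (isClosed_eq (by fun_prop) continuous_id).inter
    (isClosed_iInter fun x => isClosed_le continuous_const (by fun_prop))

theorem exists_eq_mul_of_range_mulVecLin_le {R m k l : Type*} [CommSemiring R] [Fintype k]
    [Fintype l] {W : Matrix m k R} {U : Matrix m l R}
    (h : LinearMap.range W.mulVecLin ≤ LinearMap.range U.mulVecLin) :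
    ∃ S : Matrix l k R, W = U * S := by
  classical
  have hcol (j : k) : ∃ v, U *ᵥ v = W.col j := h ⟨Pi.single j 1, W.mulVec_single_one j⟩
  choose S hS using hcol
  exact ⟨Matrix.of fun i j => S j i, by ext i j; exact (congr_fun (hS j) i).symm⟩

theorem exists_isometry_range_mulVecLin_eq {𝕜 m k : Type*} [RCLike 𝕜] [Fintype m] [Fintype k]
    (W : Matrix m k 𝕜) :
    ∃ U : Matrix m (Fin W.rank) 𝕜, Uᴴ * U = 1 ∧
      LinearMap.range U.mulVecLin = LinearMap.range W.mulVecLin := by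
  let e : (m → 𝕜) ≃ₗ[𝕜] EuclideanSpace 𝕜 m := (WithLp.linearEquiv 2 𝕜 (m → 𝕜)).symm
  let R : Submodule 𝕜 (EuclideanSpace 𝕜 m) :=
    (LinearMap.range W.mulVecLin).map (e : (m → 𝕜) →ₗ[𝕜] EuclideanSpace 𝕜 m)
  have hR : Module.finrank 𝕜 R = W.rank := LinearEquiv.finrank_map_eq e _
  let b : OrthonormalBasis (Fin W.rank) 𝕜 R :=
    (stdOrthonormalBasis 𝕜 R).reindex (finCongr hR)
  refine ⟨Matrix.of fun i l => (b l : EuclideanSpace 𝕜 m) i, ?_, ?_⟩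
  · ext l l'
    have := orthonormal_iff_ite.mp b.orthonormal l l'
    rw [Submodule.coe_inner, PiLp.inner_apply] at this
    simpa [Matrix.mul_apply, Matrix.one_apply, mul_comm] using this
  · have hspan : Submodule.span 𝕜 (Set.range fun l => (b l : EuclideanSpace 𝕜 m)) = R := by
      have := congrArg (Submodule.map R.subtype) b.toBasis.span_eq
      simpa [Submodule.map_span, ← Set.range_comp, Function.comp_def] using this
    rw [Matrix.range_mulVecLin, ← Submodule.map_injective_of_injective e.injective |>.eq_iff]
    refine Eq.trans ?_ hspan
    rw [Submodule.map_span, ← Set.range_comp]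
    rfl

section LinearPart

variable {ι κ m k : Type*} [Fintype ι] [Fintype κ]

theorem linearPart_sumElim (A : ι → Matrix m m ℝ) (B : κ → Matrix m m ℝ)
    (X : ι → Matrix k k ℝ) (Y : κ → Matrix k k ℝ) :
    linearPart (Sum.elim A B) (Sum.elim X Y) = linearPart A X + linearPart B Y := by
  simp [linearPart]

theorem linearPart_zero (A : ι → Matrix m m ℝ) : linearPart A (0 : ι → Matrix k k ℝ) = 0 := by
  simp [linearPart]

theorem zero_linearPart (X : ι → Matrix k k ℝ) : linearPart (0 : ι → Matrix m m ℝ) X = 0 := by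
  simp [linearPart]

theorem linearPart_add (A : ι → Matrix m m ℝ) (X Y : ι → Matrix k k ℝ) :
    linearPart A (X + Y) = linearPart A X + linearPart A Y := by
  simp [linearPart, Matrix.kronecker_add, Finset.sum_add_distrib]

theorem linearPart_smul (A : ι → Matrix m m ℝ) (c : ℝ) (X : ι → Matrix k k ℝ) :
    linearPart A (c • X) = c • linearPart A X := by
  simp [linearPart, Matrix.kronecker_smul, Finset.smul_sum]

theorem isHermitian_linearPart {A : ι → Matrix m m ℝ} {X : ι → Matrix k k ℝ}
    (hA : ∀ i, (A i).IsHermitian) (hX : ∀ i, (X i).IsHermitian) :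
    (linearPart A X).IsHermitian := by
  simp only [Matrix.IsHermitian, linearPart, Matrix.conjTranspose_sum,
    Matrix.conjTranspose_kronecker, (hA _).eq, (hX _).eq]

theorem isHermitian_monicPencil [DecidableEq m] [DecidableEq k]
    {A : ι → Matrix m m ℝ} {X : ι → Matrix k k ℝ}
    (hA : ∀ i, (A i).IsHermitian) (hX : ∀ i, (X i).IsHermitian) :
    (monicPencil A X).IsHermitian := by
  rw [monicPencil, Matrix.one_kronecker_one]
  exact Matrix.isHermitian_one.sub (isHermitian_linearPart hA hX)

theorem continuous_monicPencil [DecidableEq m] [DecidableEq k] (A : ι → Matrix m m ℝ) :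
    Continuous (monicPencil A : (ι → Matrix k k ℝ) → Matrix (m × k) (m × k) ℝ) := by
  refine continuous_const.sub (continuous_finsetSum _ fun i _ => continuous_matrix fun p q => ?_)
  simp only [Matrix.kroneckerMap_apply]
  fun_prop

theorem vec_one_dotProduct_linearPart_mulVec [Fintype k] [DecidableEq k]
    (C Y : ι → Matrix k k ℝ) :
    (1 : Matrix k k ℝ).vec ⬝ᵥ linearPart C Y *ᵥ (1 : Matrix k k ℝ).vec =
      ∑ i, (Y i * (C i)ᴴ).trace := by
  simp only [linearPart, Matrix.sum_mulVec, dotProduct_sum, Matrix.kronecker_mulVec_vec,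
    Matrix.vec_dotProduct_vec, Matrix.transpose_one, Matrix.one_mul, Matrix.mul_one,
    Matrix.conjTranspose_eq_transpose_of_trivial]

theorem eq_zero_of_vec_one_dotProduct_linearPart_self [Fintype k] [DecidableEq k]
    {C : ι → Matrix k k ℝ}
    (hC : (1 : Matrix k k ℝ).vec ⬝ᵥ linearPart C C *ᵥ (1 : Matrix k k ℝ).vec = 0) : C = 0 := by
  rw [vec_one_dotProduct_linearPart_mulVec, Finset.sum_eq_zero_iff_of_nonneg fun i _ =>
    (Matrix.posSemidef_self_mul_conjTranspose (C i)).trace_nonneg] at hC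
  exact funext fun i => Matrix.trace_mul_conjTranspose_self_eq_zero_iff.mp
    (hC i (Finset.mem_univ i))

end LinearPart

section AmplifiedCompression

variable {m ν r s k : Type*} [Fintype k] [DecidableEq k]

/-- The block `W_c : ℝ^r → ℝ^m` of a linear map `W : ℝ^r → (ℝ^m)^ν` that lands in the copy of
`ℝ^m` with number `c`. -/
def copyBlock (W : Matrix (m × ν) r ℝ) (c : ν) : Matrix m r ℝ :=
  W.submatrix (·, c) id

/-- The Kraus operator `W_c ⊗ I` of `amplifiedCompression W`. -/
def krausOperator (k : Type*) [DecidableEq k] (W : Matrix (m × ν) r ℝ) (c : ν) :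
    Matrix (m × k) (r × k) ℝ :=
  copyBlock W c ⊗ₖ (1 : Matrix k k ℝ)

theorem krausOperator_mul [Fintype r] (W : Matrix (m × ν) r ℝ) (S : Matrix r s ℝ) (c : ν) :
    krausOperator k (W * S) c = krausOperator k W c * S ⊗ₖ (1 : Matrix k k ℝ) := by
  rw [krausOperator, krausOperator, ← Matrix.mul_kronecker_mul, Matrix.one_mul]
  rfl

theorem krausOperator_mulVec_vec_one (W : Matrix (m × ν) k ℝ) (c : ν) :
    krausOperator k W c *ᵥ (1 : Matrix k k ℝ).vec = (copyBlock W c)ᵀ.vec := by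
  rw [krausOperator, Matrix.kronecker_mulVec_vec, Matrix.one_mul, Matrix.one_mul]

variable [Fintype m] [Fintype ν]

/-- The amplification `Φ ⊗ id` of the completely positive map `Φ(M) = W* M^{⊕ ν} W`, in Kraus
form. It turns pencils with coefficients `A` into pencils with coefficients `W* A^{⊕ ν} W`. -/
def amplifiedCompression (W : Matrix (m × ν) r ℝ) :
    Matrix (m × k) (m × k) ℝ →ₗ[ℝ] Matrix (r × k) (r × k) ℝ where
  toFun Z := ∑ c, (krausOperator k W c)ᴴ * Z * krausOperator k W c
  map_add' Z Z' := by simp only [Matrix.mul_add, Matrix.add_mul, Finset.sum_add_distrib]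
  map_smul' a Z := by simp [Finset.smul_sum]

theorem amplifiedCompression_apply (W : Matrix (m × ν) r ℝ) (Z : Matrix (m × k) (m × k) ℝ) :
    amplifiedCompression W Z = ∑ c, (krausOperator k W c)ᴴ * Z * krausOperator k W c :=
  rfl

theorem posSemidef_amplifiedCompression [Finite r] (W : Matrix (m × ν) r ℝ)
    {Z : Matrix (m × k) (m × k) ℝ} (hZ : Z.PosSemidef) :
    (amplifiedCompression W Z).PosSemidef :=
  Matrix.posSemidef_sum _ fun _ _ => hZ.conjTranspose_mul_mul_same _

theorem posSemidef_amplifiedCompression_mul [Fintype r] [Finite s] {W : Matrix (m × ν) r ℝ}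
    {Z : Matrix (m × k) (m × k) ℝ} (hZ : (amplifiedCompression W Z).PosSemidef)
    (S : Matrix r s ℝ) : (amplifiedCompression (W * S) Z).PosSemidef := by
  convert hZ.conjTranspose_mul_mul_same (S ⊗ₖ (1 : Matrix k k ℝ)) using 1
  simp only [amplifiedCompression_apply, krausOperator_mul, Matrix.conjTranspose_mul,
    Matrix.mul_sum, Matrix.sum_mul, Matrix.mul_assoc]

theorem vec_one_dotProduct_amplifiedCompression_mulVec (W : Matrix (m × ν) k ℝ)
    (Z : Matrix (m × k) (m × k) ℝ) :
    (1 : Matrix k k ℝ).vec ⬝ᵥ amplifiedCompression W Z *ᵥ (1 : Matrix k k ℝ).vec =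
      ∑ c, (copyBlock W c)ᵀ.vec ⬝ᵥ Z *ᵥ (copyBlock W c)ᵀ.vec := by
  rw [amplifiedCompression_apply, Matrix.sum_mulVec, dotProduct_sum]
  refine Finset.sum_congr rfl fun c _ => ?_
  rw [← Matrix.mulVec_mulVec, ← Matrix.mulVec_mulVec, krausOperator_mulVec_vec_one,
    Matrix.dotProduct_mulVec, Matrix.conjTranspose_eq_transpose_of_trivial,
    Matrix.vecMul_transpose, krausOperator_mulVec_vec_one]

open scoped MatrixOrder Matrix.Norms.L2Operator in
/-- The blocks of `W` are the rows of a matrix `V` with `P = V* V`. -/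
theorem exists_trace_mul_eq_vec_one_dotProduct_amplifiedCompression
    (e : m × k ≃ ν) {P : Matrix (m × k) (m × k) ℝ} (hP : P.PosSemidef) :
    ∃ W : Matrix (m × ν) k ℝ, ∀ Z : Matrix (m × k) (m × k) ℝ,
      (P * Z).trace =
        (1 : Matrix k k ℝ).vec ⬝ᵥ amplifiedCompression W Z *ᵥ (1 : Matrix k k ℝ).vec := by
  classical
  obtain ⟨V, rfl⟩ := CStarAlgebra.nonneg_iff_eq_star_mul_self.mp hP.nonneg
  refine ⟨Matrix.of fun p j => V (e.symm p.2) (p.1, j), fun Z => ?_⟩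
  calc (star V * V * Z).trace = (V * Z * Vᵀ).trace := by
        rw [Matrix.mul_assoc, Matrix.trace_mul_comm, Matrix.star_eq_conjTranspose,
          Matrix.conjTranspose_eq_transpose_of_trivial]
    _ = ∑ q, V q ⬝ᵥ Z *ᵥ V q := by
        simp only [Matrix.trace, Matrix.diag_apply, Matrix.mul_mul_apply,
          Matrix.transpose_transpose]
    _ = ∑ c, V (e.symm c) ⬝ᵥ Z *ᵥ V (e.symm c) := (e.symm.sum_comp _).symm
    _ = _ := by rw [vec_one_dotProduct_amplifiedCompression_mulVec]; rfl

end AmplifiedCompression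

section Compression

variable {d N r s : ℕ} {k : Type*} [Fintype k] [DecidableEq k]

theorem conjTranspose_mul_directSumCopies_mul (W : Matrix (Fin d × Fin N) (Fin r) ℝ)
    (M : Matrix (Fin d) (Fin d) ℝ) :
    Wᴴ * directSumCopies M N * W = ∑ c, (copyBlock W c)ᴴ * M * copyBlock W c := by
  ext i j
  simp only [directSumCopies, Matrix.mul_apply, Matrix.sum_apply, Matrix.blockDiagonal_apply,
    Fintype.sum_prod_type, mul_ite, mul_zero, Finset.sum_ite_eq', Finset.mem_univ, if_true]
  exact Finset.sum_comm

theorem directSumCopies_one (d N : ℕ) :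
    directSumCopies (1 : Matrix (Fin d) (Fin d) ℝ) N = 1 :=
  Matrix.blockDiagonal_one

theorem amplifiedCompression_kronecker (W : Matrix (Fin d × Fin N) (Fin r) ℝ)
    (M : Matrix (Fin d) (Fin d) ℝ) (Y : Matrix k k ℝ) :
    amplifiedCompression W (M ⊗ₖ Y) = (Wᴴ * directSumCopies M N * W) ⊗ₖ Y := by
  simp only [amplifiedCompression_apply, krausOperator, conjTranspose_mul_directSumCopies_mul,
    Matrix.conjTranspose_kronecker, ← Matrix.mul_kronecker_mul, Matrix.conjTranspose_one,
    Matrix.one_mul, Matrix.mul_one]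
  ext p q
  simp only [Matrix.kroneckerMap_apply, Matrix.sum_apply, Finset.sum_mul]

theorem amplifiedCompression_linearPart {ι : Type*} [Fintype ι]
    (W : Matrix (Fin d × Fin N) (Fin r) ℝ) (A : ι → Matrix (Fin d) (Fin d) ℝ)
    (X : ι → Matrix k k ℝ) :
    amplifiedCompression W (linearPart A X) = linearPart (compression A W) X := by
  simp only [linearPart, map_sum, amplifiedCompression_kronecker, compression]

theorem amplifiedCompression_monicPencil {ι : Type*} [Fintype ι]
    (W : Matrix (Fin d × Fin N) (Fin r) ℝ) (A : ι → Matrix (Fin d) (Fin d) ℝ)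
    (X : ι → Matrix k k ℝ) :
    amplifiedCompression W (monicPencil A X) =
      (Wᴴ * W) ⊗ₖ (1 : Matrix k k ℝ) - linearPart (compression A W) X := by
  rw [monicPencil, map_sub, amplifiedCompression_kronecker, amplifiedCompression_linearPart,
    directSumCopies_one, Matrix.mul_one]

theorem amplifiedCompression_monicPencil_of_isometry {ι : Type*} [Fintype ι]
    {W : Matrix (Fin d × Fin N) (Fin r) ℝ} (hW : Wᴴ * W = 1) (A : ι → Matrix (Fin d) (Fin d) ℝ)
    (X : ι → Matrix k k ℝ) :
    amplifiedCompression W (monicPencil A X) = monicPencil (compression A W) X := by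
  rw [amplifiedCompression_monicPencil, hW, monicPencil]

theorem compression_mul {ι : Type*} (A : ι → Matrix (Fin d) (Fin d) ℝ)
    (W : Matrix (Fin d × Fin N) (Fin r) ℝ) (S : Matrix (Fin r) (Fin s) ℝ) :
    compression A (W * S) = fun i => Sᴴ * compression A W i * S := by
  funext i
  simp only [compression, Matrix.conjTranspose_mul, Matrix.mul_assoc]

theorem compression_mem_selfAdjointTuples {ι : Type*} {A : ι → Matrix (Fin d) (Fin d) ℝ}
    (hA : A ∈ selfAdjointTuples ι d) (W : Matrix (Fin d × Fin N) (Fin r) ℝ) :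
    compression A W ∈ selfAdjointTuples ι r := fun i => by
  refine Matrix.isHermitian_conjTranspose_mul_mul W ?_
  rw [Matrix.IsHermitian, directSumCopies, Matrix.blockDiagonal_conjTranspose, (hA i).eq]

end Compression

section Spectrahedrop

variable {g h d n : ℕ} {A : Fin g → Matrix (Fin d) (Fin d) ℝ}
  {B : Fin h → Matrix (Fin d) (Fin d) ℝ} {X : Fin g → Matrix (Fin n) (Fin n) ℝ}

theorem smul_mem_selfAdjointTuples {ι : Type*} {X : ι → Matrix (Fin n) (Fin n) ℝ}
    (hX : X ∈ selfAdjointTuples ι n) (c : ℝ) : c • X ∈ selfAdjointTuples ι n :=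
  fun i => (hX i).smul (.all c)

/-- The space of values of the homogeneous pencil `Λ_B` at tuples of symmetric `n × n` matrices. -/
def linearPartRange (B : Fin h → Matrix (Fin d) (Fin d) ℝ) (n : ℕ) :
    Submodule ℝ (Matrix (Fin d × Fin n) (Fin d × Fin n) ℝ) where
  carrier := linearPart B '' selfAdjointTuples (Fin h) n
  add_mem' := by
    rintro _ _ ⟨Y, hY, rfl⟩ ⟨Y', hY', rfl⟩
    exact ⟨Y + Y', fun i => (hY i).add (hY' i), linearPart_add B Y Y'⟩
  zero_mem' := ⟨0, fun _ => Matrix.isHermitian_zero, linearPart_zero B⟩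
  smul_mem' := by
    rintro c _ ⟨Y, hY, rfl⟩
    exact ⟨c • Y, smul_mem_selfAdjointTuples hY c, linearPart_smul B c Y⟩

theorem linearPart_mem_linearPartRange {Y : Fin h → Matrix (Fin n) (Fin n) ℝ}
    (hY : Y ∈ selfAdjointTuples (Fin h) n) : linearPart B Y ∈ linearPartRange B n :=
  ⟨Y, hY, rfl⟩

theorem isHermitian_of_mem_linearPartRange (hB : B ∈ selfAdjointTuples (Fin h) d)
    {Z : Matrix (Fin d × Fin n) (Fin d × Fin n) ℝ} (hZ : Z ∈ linearPartRange B n) :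
    Z.IsHermitian := by
  obtain ⟨Y, hY, rfl⟩ := hZ
  exact isHermitian_linearPart hB hY

theorem amplifiedCompression_eq_zero_of_mem_linearPartRange {N r : ℕ}
    {W : Matrix (Fin d × Fin N) (Fin r) ℝ} (hW : compression B W = 0)
    {Z : Matrix (Fin d × Fin n) (Fin d × Fin n) ℝ} (hZ : Z ∈ linearPartRange B n) :
    amplifiedCompression W Z = 0 := by
  obtain ⟨Y, -, rfl⟩ := hZ
  rw [amplifiedCompression_linearPart, hW, zero_linearPart]

theorem mem_freeSpectrahedrop_iff :
    X ∈ freeSpectrahedrop A B n ↔ X ∈ selfAdjointTuples (Fin g) n ∧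
      ∃ Z ∈ linearPartRange B n, (monicPencil A X - Z).PosSemidef := by
  have hpencil (Y : Fin h → Matrix (Fin n) (Fin n) ℝ) :
      monicPencil (Sum.elim A B) (Sum.elim X Y) = monicPencil A X - linearPart B Y := by
    rw [monicPencil, monicPencil, linearPart_sumElim, sub_sub]
  refine and_congr_right fun hX => ⟨?_, ?_⟩
  · rintro ⟨Y, hY, -, hpos⟩
    exact ⟨_, linearPart_mem_linearPartRange hY, hpencil Y ▸ hpos⟩
  · rintro ⟨_, ⟨Y, hY, rfl⟩, hpos⟩
    exact ⟨Y, hY, Sum.rec hX hY, (hpencil Y).symm ▸ hpos⟩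

theorem posSemidef_amplifiedCompression_of_mem_closure {N r : ℕ}
    {W : Matrix (Fin d × Fin N) (Fin r) ℝ} (hW : compression B W = 0)
    (hX : X ∈ closure (freeSpectrahedrop A B n)) :
    (amplifiedCompression W (monicPencil A X)).PosSemidef := by
  have hcont : Continuous fun X : Fin g → Matrix (Fin n) (Fin n) ℝ =>
      amplifiedCompression W (monicPencil A X) :=
    (LinearMap.continuous_of_finiteDimensional _).comp (continuous_monicPencil A)
  refine closure_minimal (fun X hX => ?_) (isClosed_setOf_posSemidef.preimage hcont) hX
  obtain ⟨-, Z, hZ, hpos⟩ := mem_freeSpectrahedrop_iff.mp hX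
  have := posSemidef_amplifiedCompression W hpos
  rwa [map_sub, amplifiedCompression_eq_zero_of_mem_linearPartRange hW hZ, sub_zero] at this

/-- Testing against the value of `Λ_B` at `Y = W* B^{⊕ N} W` itself gives `∑ i, tr (Y i)² = 0`. -/
theorem compression_eq_zero_of_forall_linearPartRange {N : ℕ}
    (hB : B ∈ selfAdjointTuples (Fin h) d) {W : Matrix (Fin d × Fin N) (Fin n) ℝ}
    (hW : ∀ Z ∈ linearPartRange B n, (1 : Matrix (Fin n) (Fin n) ℝ).vec ⬝ᵥ
      amplifiedCompression W Z *ᵥ (1 : Matrix (Fin n) (Fin n) ℝ).vec = 0) :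
    compression B W = 0 := by
  have := hW _ (linearPart_mem_linearPartRange (compression_mem_selfAdjointTuples hB W))
  rw [amplifiedCompression_linearPart] at this
  exact eq_zero_of_vec_one_dotProduct_linearPart_self this

open scoped Pointwise in
theorem monicPencil_mem_closure_of_forall_setZ
    (hA : A ∈ selfAdjointTuples (Fin g) d) (hB : B ∈ selfAdjointTuples (Fin h) d)
    (hX : X ∈ selfAdjointTuples (Fin g) n)
    (hZ : ∀ W ∈ setZ B n, (amplifiedCompression W (monicPencil A X)).PosSemidef) :
    monicPencil A X ∈ closure ({P : Matrix (Fin d × Fin n) (Fin d × Fin n) ℝ | P.PosSemidef} +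
      (linearPartRange B n : Set (Matrix (Fin d × Fin n) (Fin d × Fin n) ℝ))) := by
  refine mem_closure_posSemidef_add_of_trace_nonneg
    (fun _ => isHermitian_of_mem_linearPartRange hB) (isHermitian_monicPencil hA hX)
    fun P hP hPB => ?_
  obtain ⟨W, hW⟩ := exists_trace_mul_eq_vec_one_dotProduct_amplifiedCompression
    ((Equiv.prodComm (Fin d) (Fin n)).trans finProdFinEquiv) hP
  simp only [hW] at hPB ⊢
  have hWB : W ∈ setZ B n := compression_eq_zero_of_forall_linearPartRange hB hPB
  exact (hZ W hWB).dotProduct_mulVec_nonneg (1 : Matrix (Fin n) (Fin n) ℝ).vec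

open scoped Pointwise in
theorem inv_smul_mem_freeSpectrahedrop
    (hA : A ∈ selfAdjointTuples (Fin g) d) (hB : B ∈ selfAdjointTuples (Fin h) d)
    (hX : X ∈ selfAdjointTuples (Fin g) n)
    (hmem : monicPencil A X ∈
      closure ({P : Matrix (Fin d × Fin n) (Fin d × Fin n) ℝ | P.PosSemidef} +
        (linearPartRange B n : Set (Matrix (Fin d × Fin n) (Fin d × Fin n) ℝ))))
    {ε : ℝ} (hε : 0 < ε) : (1 + ε)⁻¹ • X ∈ freeSpectrahedrop A B n := by
  obtain ⟨Z, hZ, hpos⟩ := exists_posSemidef_smul_one_add_sub_of_mem_closure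
    (fun _ => isHermitian_of_mem_linearPartRange hB) (isHermitian_monicPencil hA hX) hmem hε
  have hε' : 0 < 1 + ε := by positivity
  refine mem_freeSpectrahedrop_iff.mpr ⟨smul_mem_selfAdjointTuples hX _, (1 + ε)⁻¹ • Z,
    Submodule.smul_mem _ _ hZ, ?_⟩
  convert hpos.smul (inv_nonneg.mpr hε'.le) using 1
  rw [monicPencil, monicPencil, linearPart_smul, Matrix.one_kronecker_one]
  match_scalars <;> field_simp
  ring

theorem mem_closure_freeSpectrahedrop_of_forall_setZ
    (hA : A ∈ selfAdjointTuples (Fin g) d) (hB : B ∈ selfAdjointTuples (Fin h) d)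
    (hX : X ∈ selfAdjointTuples (Fin g) n)
    (hZ : ∀ W ∈ setZ B n, (amplifiedCompression W (monicPencil A X)).PosSemidef) :
    X ∈ closure (freeSpectrahedrop A B n) := by
  have hmem := monicPencil_mem_closure_of_forall_setZ hA hB hX hZ
  have hcont : ContinuousAt (fun ε : ℝ => (1 + ε)⁻¹ • X) 0 := by
    fun_prop (disch := norm_num)
  have hlim := hcont.tendsto.mono_left (nhdsWithin_le_nhds (s := Set.Ioi 0))
  rw [add_zero, inv_one, one_smul] at hlim
  exact mem_closure_of_tendsto hlim (Filter.eventually_of_mem self_mem_nhdsWithin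
    fun ε hε => inv_smul_mem_freeSpectrahedrop hA hB hX hmem hε)

theorem exists_mem_setIUnion_eq_mul {W : Matrix (Fin d × Fin (n * d)) (Fin n) ℝ}
    (hW : W ∈ setZ B n) :
    ∃ U ∈ setIUnion B n, ∃ S : Matrix (Fin U.1) (Fin n) ℝ, W = U.2 * S := by
  obtain ⟨U, hU, hrange⟩ := exists_isometry_range_mulVecLin_eq W
  obtain ⟨S, hS⟩ := exists_eq_mul_of_range_mulVecLin_le hrange.ge
  obtain ⟨T, hT⟩ := exists_eq_mul_of_range_mulVecLin_le hrange.le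
  have hUB : compression B U = 0 := by
    rw [hT, compression_mul, show compression B W = 0 from hW]
    funext i
    simp only [Pi.zero_apply, Matrix.mul_zero, Matrix.zero_mul]
  exact ⟨⟨W.rank, U⟩, ⟨W.rank_le_card_width.trans_eq (Fintype.card_fin n), hUB, hU⟩, S, hS⟩

theorem IsFreeClosed.isClosed {K : (n : ℕ) → Set (Fin g → Matrix (Fin n) (Fin n) ℝ)}
    (hK : IsFreeClosed K) (n : ℕ) : IsClosed (K n) := by
  rcases n.eq_zero_or_pos with rfl | hn
  · exact Set.subsingleton_of_subsingleton.isClosed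
  · exact hK n hn

end Spectrahedrop

theorem theorem2p1_general {g h d : ℕ}
    (A : Fin g → Matrix (Fin d) (Fin d) ℝ) (B : Fin h → Matrix (Fin d) (Fin d) ℝ)
    (hA : A ∈ selfAdjointTuples (Fin g) d) (hB : B ∈ selfAdjointTuples (Fin h) d)
    (n : ℕ) (X : Fin g → Matrix (Fin n) (Fin n) ℝ) (hX : X ∈ selfAdjointTuples (Fin g) n) :
    (X ∈ closure (freeSpectrahedrop A B n) ↔
      ∀ W ∈ setZ B n,
        ((Wᴴ * W) ⊗ₖ (1 : Matrix (Fin n) (Fin n) ℝ)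
          - linearPart (compression A W) X).PosSemidef) ∧
    (X ∈ closure (freeSpectrahedrop A B n) ↔
      ∀ W ∈ setIUnion B n, (monicPencil (compression A W.2) X).PosSemidef) ∧
    (X ∈ closure (freeSpectrahedrop A B n) →
      ∀ m : ℕ, ∀ W ∈ setIUnion B m, (monicPencil (compression A W.2) X).PosSemidef) := by
  have hZ_of_mem (hmem : X ∈ closure (freeSpectrahedrop A B n)) : ∀ W ∈ setZ B n,
      (amplifiedCompression W (monicPencil A X)).PosSemidef :=
    fun _ hW => posSemidef_amplifiedCompression_of_mem_closure hW hmem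
  have hI_of_mem (hmem : X ∈ closure (freeSpectrahedrop A B n)) (m : ℕ) : ∀ W ∈ setIUnion B m,
      (monicPencil (compression A W.2) X).PosSemidef := fun W ⟨_, hWB, hWW⟩ =>
    amplifiedCompression_monicPencil_of_isometry hWW A X ▸
      posSemidef_amplifiedCompression_of_mem_closure hWB hmem
  have mem_of_hZ := mem_closure_freeSpectrahedrop_of_forall_setZ hA hB hX
  have hZ_of_hI (hI : ∀ W ∈ setIUnion B n, (monicPencil (compression A W.2) X).PosSemidef) :
      ∀ W ∈ setZ B n, (amplifiedCompression W (monicPencil A X)).PosSemidef := by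
    intro W hW
    obtain ⟨U, hU, S, rfl⟩ := exists_mem_setIUnion_eq_mul hW
    refine posSemidef_amplifiedCompression_mul ?_ S
    exact amplifiedCompression_monicPencil_of_isometry hU.2.2 A X ▸ hI U hU
  simp only [← amplifiedCompression_monicPencil]
  exact ⟨⟨hZ_of_mem, mem_of_hZ⟩, ⟨fun hmem => hI_of_mem hmem n, fun hI => mem_of_hZ (hZ_of_hI hI)⟩,
    hI_of_mem⟩

theorem theorem2p1 {g h d : ℕ}
    (A : Fin g → Matrix (Fin d) (Fin d) ℝ) (B : Fin h → Matrix (Fin d) (Fin d) ℝ)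
    (hA : A ∈ selfAdjointTuples (Fin g) d) (hB : B ∈ selfAdjointTuples (Fin h) d)
    (hclosed : IsFreeClosed (freeSpectrahedrop A B))
    (hbounded : IsFreeBounded (freeSpectrahedrop A B))
    (n : ℕ) (X : Fin g → Matrix (Fin n) (Fin n) ℝ) (hX : X ∈ selfAdjointTuples (Fin g) n) :
    (X ∈ freeSpectrahedrop A B n ↔
      ∀ W ∈ setZ B n,
        ((Wᴴ * W) ⊗ₖ (1 : Matrix (Fin n) (Fin n) ℝ)
          - linearPart (compression A W) X).PosSemidef) ∧
    (X ∈ freeSpectrahedrop A B n ↔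
      ∀ W ∈ setIUnion B n, (monicPencil (compression A W.2) X).PosSemidef) ∧
    (X ∈ freeSpectrahedrop A B n →
      ∀ m : ℕ, ∀ W ∈ setIUnion B m, (monicPencil (compression A W.2) X).PosSemidef) := by
  rw [← (hclosed.isClosed n).closure_eq]
  exact theorem2p1_general A B hA hB n X hX
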